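/- Let $s$ and $i$ be integers with $s>1$, $0<i<s$ and $\gcd(i,s)=1$, let $q=2^s$ and $h=\frac{q-2^i}{2}$, and let $\beta$ be a primitive $(q+1)$-th root of unity in an extension field of $\mathbb{F}_q$. Let $\mathcal{C}_{(q,q+1,3,h)}$ be the BCH code over $\mathbb{F}_q$ of length $q+1$ and designed distance $3$, that is, the set of all $(c_0,\dots,c_q)\in\mathbb{F}_q^{q+1}$ such that the class of $c_0+c_1x+\cdots+c_qx^q$ lies in the ideal of $\mathbb{F}_q[x]/(x^{q+1}-1)$ generated by $\mathrm{lcm}\left(\mathrm{M}_{\beta^h}(x),\mathrm{M}_{\beta^{h+1}}(x)\right)$, where $\mathrm{M}_{\gamma}(x)$ denotes the minimal polynomial of $\gamma$ over $\mathbb{F}_q$. An $[n,k,d]$ code is a linear code of length $n$, dimension $k$ and minimum distance $d$, and it is MDS if $d=n-k+1$. Then $\mathcal{C}_{(q,q+1,3,h)}$ is an MDS code with parameters $[q+1,q-3,5]$, and its dual code $\mathcal{C}^\perp_{(q,q+1,3,h)}=\{\mathbf{v}\in\mathbb{F}_q^{q+1}: \mathbf{c}\cdot\mathbf{v}=0 \text{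 for all } \mathbf{c}\in\mathcal{C}_{(q,q+1,3,h)}\}$ is an MDS code with parameters $[q+1,4,q-2]$. -/

import Mathlib

open Polynomial

noncomputable section

namespace BCH

/-- The linear code `C ⊆ F ^ n` has dimension `k` and minimum distance `d` (the least Hamming
weight of a nonzero codeword): it is an `[n, k, d]` code. -/
def HasParameters {F : Type*} [Field F] {n : ℕ} (C : Submodule F (Fin n → F)) (k d : ℕ) : Prop :=
  open Classical in
  Module.finrank F C = k ∧
    IsLeast {w : ℕ | ∃ c ∈ C, c ≠ 0 ∧ hammingNorm c = w} d

/-- Maximum distance separable: an `[n, k, d]` code meeting the Singleton bound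
`d ≤ n - k + 1` with equality. -/
def IsMDS {F : Type*} [Field F] {n : ℕ} (C : Submodule F (Fin n → F)) : Prop :=
  ∃ k d : ℕ, HasParameters C k d ∧ d + k = n + 1

/-- The dual code with respect to the standard inner product on `F ^ n`. -/
def dualCode {F : Type*} [Field F] {n : ℕ} (C : Submodule F (Fin n → F)) :
    Submodule F (Fin n → F) where
  carrier := {v | ∀ c ∈ C, c ⬝ᵥ v = 0}
  zero_mem' := fun c _ => dotProduct_zero c
  add_mem' := fun {v w} hv hw c hc => by rw [dotProduct_add, hv c hc, hw c hc, add_zero]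
  smul_mem' := fun a v hv c hc => by rw [dotProduct_smul, hv c hc, smul_zero]

/-- The identification `F ^ n → F[x] / (x ^ n - 1)`,
`(c_0, …, c_{n-1}) ↦ c_0 + c_1 x + ⋯ + c_{n-1} x ^ (n-1)`. -/
def wordToResidue (F : Type*) [Field F] (n : ℕ) :
    (Fin n → F) →ₗ[F] F[X] ⧸ Ideal.span {(X : F[X]) ^ n - 1} :=
  (Ideal.Quotient.mkₐ F (Ideal.span {(X : F[X]) ^ n - 1})).toLinearMap ∘ₗ
    Fintype.linearCombination F (fun j : Fin n => (X : F[X]) ^ (j : ℕ))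

/-- The cyclic code of length `n` generated by `g`: the words corresponding to the elements of
the ideal generated by `g` in `F[x] / (x ^ n - 1)`. -/
def cyclicCode {F : Type*} [Field F] (n : ℕ) (g : F[X]) : Submodule F (Fin n → F) :=
  ((Ideal.span {Ideal.Quotient.mk (Ideal.span {(X : F[X]) ^ n - 1}) g}).restrictScalars F).comap
    (wordToResidue F n)

/-- The polynomial `lcm (M_{β^h}, M_{β^(h+1)}, …, M_{β^(h+δ-2)})`, where `M_{β^j}` is the minimal
polynomial of `β ^ j` over `F` and the (monic) least common multiple is computed in `F[x]`. -/
def bchGenerator (F : Type*) [Field F] {K : Type*} [Field K] [Algebra F K]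
    (β : K) (δ h : ℕ) : F[X] :=
  open Classical in
  letI : NormalizedGCDMonoid F[X] := UniqueFactorizationMonoid.toNormalizedGCDMonoid F[X]
  (Finset.range (δ - 1)).lcm (fun j => minpoly F (β ^ (h + j)))

/-- The BCH code over `F` of length `n` and designed distance `δ` with first exponent `h`, formed
with the primitive `n`-th root of unity `β` in an extension field of `F`. -/
def bchCode (F : Type*) [Field F] {K : Type*} [Field K] [Algebra F K]
    (β : K) (n δ h : ℕ) : Submodule F (Fin n → F) :=
  cyclicCode n (bchGenerator F β δ h)

end BCH

end

/-! Put `x_j = β ^ j`. A word `c` is in the code iff `∑ c_j x_j ^ h = ∑ c_j x_j ^ (h+1) = 0`. The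
`q`-Frobenius fixes `c_j` and inverts `x_j`, and `2h + 2^i = q ≡ -1` modulo `q + 1`, so `e_j = c_j
x_j ^ h` is orthogonal to `x_j ^ m` for `m = 0, 1, 2^i, 2^i + 1`.

If `e` lived on four points, testing it against products `(x - u)(x ^ 2^i - v)` would make their
cross-ratio a fixed point of `y ↦ y ^ 2^i` (`eq_zero_of_four_relations`). Cross-ratios are invariant
under inversion, so it is also fixed by `y ↦ y ^ 2^s`, hence lies in `{0, 1}` as `gcd(i, s) = 1`;
distinct points forbid this (`crossRatio_pow_ne`). Thus `d ≥ 5`.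

Both minimal polynomials have degree at most 2, so the dimension is at least `q - 3`. The Singleton
bound forces equality, and the dual of an MDS code is MDS. -/

namespace BCH

/-! ### Singleton bound, MDS codes and duality. -/

section MDS

variable {F : Type*} [Field F] {n : ℕ}

/-- Restriction of the words of a code to the coordinates in `T`. -/
def restrictCoords (C : Submodule F (Fin n → F)) (T : Finset (Fin n)) : C →ₗ[F] (T → F) :=
  (LinearMap.funLeft F F (Subtype.val : T → Fin n)) ∘ₗ C.subtype

open Classical in
lemma hammingNorm_le_of_eq_zero_on {v : Fin n → F} {T : Finset (Fin n)}
    (h : ∀ j ∈ T, v j = 0) : hammingNorm v + T.card ≤ n := by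
  have hsub : Finset.univ.filter (fun j => v j ≠ 0) ⊆ Tᶜ := by
    intro j hj
    rw [Finset.mem_compl]
    intro hT
    exact (Finset.mem_filter.1 hj).2 (h j hT)
  have h1 := Finset.card_le_card hsub
  have h2 := Finset.card_add_card_compl T
  rw [Fintype.card_fin] at h2
  unfold hammingNorm
  omega

open Classical in
lemma restrictCoords_injective {C : Submodule F (Fin n → F)} {d : ℕ}
    (hd : ∀ c ∈ C, c ≠ 0 → d ≤ hammingNorm c) {T : Finset (Fin n)} (hT : n < T.card + d) :
    Function.Injective (restrictCoords C T) := by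
  rw [← LinearMap.ker_eq_bot, LinearMap.ker_eq_bot']
  rintro ⟨c, hc⟩ h0
  by_contra hne
  have h1 := hd c hc (fun h => hne (by ext1; exact h))
  have h2 := hammingNorm_le_of_eq_zero_on (v := c) (T := T)
    (fun j hj => congrFun h0 (⟨j, hj⟩ : T))
  omega

open Classical in
/-- The Singleton bound. -/
lemma finrank_add_le {C : Submodule F (Fin n → F)} {d : ℕ} (hdn : d ≤ n + 1) (hd0 : 0 < d)
    (hd : ∀ c ∈ C, c ≠ 0 → d ≤ hammingNorm c) : Module.finrank F C + d ≤ n + 1 := by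
  obtain ⟨T, -, hT⟩ := Finset.exists_subset_card_eq
    (s := (Finset.univ : Finset (Fin n))) (n := n + 1 - d) (by simp; omega)
  have h := LinearMap.finrank_le_finrank_of_injective
    (restrictCoords_injective hd (T := T) (by omega))
  rw [Module.finrank_fintype_fun_eq_card, Fintype.card_coe, hT] at h
  omega

open Classical in
lemma exists_hammingNorm_eq {C : Submodule F (Fin n → F)} {d : ℕ} (hdn : d ≤ n)
    (hdim : n < Module.finrank F C + d)
    (hd : ∀ c ∈ C, c ≠ 0 → d ≤ hammingNorm c) : ∃ c ∈ C, c ≠ 0 ∧ hammingNorm c = d := by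
  obtain ⟨T, -, hT⟩ := Finset.exists_subset_card_eq
    (s := (Finset.univ : Finset (Fin n))) (n := n - d) (by simp)
  -- The dimension exceeds `n - d`, so some nonzero codeword vanishes on all of `T`; its weight is
  -- then at most `d`.
  have hker : LinearMap.ker (restrictCoords C T) ≠ ⊥ := by
    apply LinearMap.ker_ne_bot_of_finrank_lt
    rw [Module.finrank_fintype_fun_eq_card, Fintype.card_coe, hT]
    omega
  obtain ⟨⟨c, hc⟩, h0, hne⟩ := Submodule.exists_mem_ne_zero_of_ne_bot hker
  have hne' : c ≠ 0 := fun h => hne (by ext1; exact h)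
  refine ⟨c, hc, hne', le_antisymm ?_ (hd c hc hne')⟩
  have h2 := hammingNorm_le_of_eq_zero_on (v := c) (T := T)
    (fun j hj => congrFun (LinearMap.mem_ker.1 h0) (⟨j, hj⟩ : T))
  omega

open Classical in
lemma hasParameters_of_le_hammingNorm {C : Submodule F (Fin n → F)} {k d : ℕ} (hdn : d ≤ n)
    (hk : Module.finrank F C = k) (hkd : d + k = n + 1)
    (hd : ∀ c ∈ C, c ≠ 0 → d ≤ hammingNorm c) : HasParameters C k d := by
  refine ⟨hk, ?_, ?_⟩
  · obtain ⟨c, h1, h2, h3⟩ := exists_hammingNorm_eq hdn (by omega) hd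
    exact ⟨c, h1, h2, by convert h3⟩
  · rintro w ⟨c, h1, h2, rfl⟩
    convert hd c h1 h2

lemma finrank_dualCode (C : Submodule F (Fin n → F)) :
    Module.finrank F C + Module.finrank F (dualCode C) = n := by
  have h : (dualCode C).map (dotProductEquiv F (Fin n)).toLinearMap = C.dualAnnihilator := by
    ext φ
    rw [Submodule.mem_map, Submodule.mem_dualAnnihilator]
    constructor
    · rintro ⟨v, hv, rfl⟩ c hc
      have := hv c hc
      rw [dotProduct_comm] at this
      simpa using this
    · intro hφ
      refine ⟨(dotProductEquiv F (Fin n)).symm φ, fun c hc => ?_, by simp⟩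
      have := hφ c hc
      obtain ⟨v, rfl⟩ := (dotProductEquiv F (Fin n)).surjective φ
      rw [LinearEquiv.symm_apply_apply, dotProduct_comm]
      simpa using this
  have h1 := Subspace.finrank_add_finrank_dualAnnihilator_eq C
  rw [← h, LinearEquiv.finrank_map_eq] at h1
  simpa using h1

-- In an MDS code any `dim C` coordinates can be prescribed freely. If `v` were supported on such a
-- set `T`, a codeword equal to 1 at one point of the support and 0 on the rest of `T` would pair
-- with `v` to a nonzero value.
open Classical in
lemma lt_hammingNorm_of_mem_dualCode {C : Submodule F (Fin n → F)} {d : ℕ}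
    (hdim : Module.finrank F C + d = n + 1) (hd0 : 0 < d)
    (hd : ∀ c ∈ C, c ≠ 0 → d ≤ hammingNorm c) {v : Fin n → F} (hv : v ∈ dualCode C)
    (hne : v ≠ 0) : Module.finrank F C < hammingNorm v := by
  by_contra! hle
  obtain ⟨T, hsub, -, hT⟩ := Finset.exists_subsuperset_card_eq
    (Finset.subset_univ (Finset.univ.filter fun j => v j ≠ 0)) hle (by simp; omega)
  have hinj := restrictCoords_injective hd (T := T) (by omega)
  have hsurj : Function.Surjective (restrictCoords C T) :=
    (LinearMap.injective_iff_surjective_of_finrank_eq_finrank (by simp [hT])).1 hinj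
  obtain ⟨j, hj⟩ := Function.ne_iff.1 hne
  have hjT : j ∈ T := hsub (by simpa using hj)
  obtain ⟨⟨c, hc⟩, hcT⟩ := hsurj (Pi.single ⟨j, hjT⟩ 1)
  have h0 : c ⬝ᵥ v = 0 := hv c hc
  have h1 : c ⬝ᵥ v = v j := by
    rw [dotProduct, Finset.sum_eq_single j]
    · have : c j = 1 := by simpa [restrictCoords] using congrFun hcT ⟨j, hjT⟩
      rw [this, one_mul]
    · intro l _ hl
      by_cases hlT : l ∈ T
      · have : c l = 0 := by
          have h := congrFun hcT ⟨l, hlT⟩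
          rw [Pi.single_eq_of_ne (fun h => hl (congrArg Subtype.val h))] at h
          exact h
        rw [this, zero_mul]
      · have : v l = 0 := by
          by_contra h
          exact hlT (hsub (by simpa using h))
        rw [this, mul_zero]
    · simp
  exact hj (h1.symm.trans h0)

end MDS

/-! ### Codewords as polynomials vanishing at the prescribed powers of `β`. -/

section Membership

variable {F : Type*} [Field F] {K : Type*} [Field K] [Algebra F K]

lemma mem_cyclicCode {n : ℕ} {g : F[X]} {c : Fin n → F} :
    c ∈ cyclicCode n g ↔
      ∃ a b : F[X], ∑ j : Fin n, c j • (X : F[X]) ^ (j : ℕ) = a * g + b * (X ^ n - 1) := by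
  have hw : wordToResidue F n c = Ideal.Quotient.mk (Ideal.span {(X : F[X]) ^ n - 1})
      (∑ j : Fin n, c j • (X : F[X]) ^ (j : ℕ)) := by
    simp only [wordToResidue, LinearMap.comp_apply, Fintype.linearCombination_apply]
    rfl
  rw [cyclicCode, Submodule.mem_comap, Submodule.restrictScalars_mem, hw,
    Ideal.mem_span_singleton']
  constructor
  · rintro ⟨a, ha⟩
    obtain ⟨a, rfl⟩ := Ideal.Quotient.mk_surjective a
    rw [← map_mul, eq_comm, Ideal.Quotient.mk_eq_mk_iff_sub_mem, Ideal.mem_span_singleton'] at ha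
    obtain ⟨b, hb⟩ := ha
    exact ⟨a, b, by rw [hb]; ring⟩
  · rintro ⟨a, b, hab⟩
    refine ⟨Ideal.Quotient.mk _ a, ?_⟩
    rw [← map_mul, eq_comm, Ideal.Quotient.mk_eq_mk_iff_sub_mem, Ideal.mem_span_singleton']
    exact ⟨b, by rw [hab]; ring⟩

lemma mem_bchCode {n : ℕ} {β : K} (hβ : β ^ n = 1) {δ h : ℕ} {c : Fin n → F} :
    c ∈ bchCode F β n δ h ↔
      ∀ k < δ - 1, ∑ j : Fin n, c j • (β ^ (h + k)) ^ (j : ℕ) = 0 := by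
  classical
  have hev : ∀ k, aeval (β ^ (h + k)) (∑ j : Fin n, c j • (X : F[X]) ^ (j : ℕ)) =
      ∑ j : Fin n, c j • (β ^ (h + k)) ^ (j : ℕ) := fun k => by simp
  simp only [bchCode, mem_cyclicCode, ← hev]
  constructor
  · rintro ⟨a, b, hab⟩ k hk
    have hdvd : minpoly F (β ^ (h + k)) ∣ bchGenerator F β δ h := by
      unfold bchGenerator
      let : NormalizedGCDMonoid F[X] := UniqueFactorizationMonoid.toNormalizedGCDMonoid F[X]
      exact Finset.dvd_lcm (f := fun j => minpoly F (β ^ (h + j))) (Finset.mem_range.2 hk)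
    obtain ⟨g, hg⟩ := hdvd
    have hroot : (β ^ (h + k)) ^ n = 1 := by rw [← pow_mul, mul_comm, pow_mul, hβ, one_pow]
    rw [hab, hg]
    simp [hroot]
  · intro hall
    have hdvd : bchGenerator F β δ h ∣ ∑ j : Fin n, c j • (X : F[X]) ^ (j : ℕ) := by
      unfold bchGenerator
      let : NormalizedGCDMonoid F[X] := UniqueFactorizationMonoid.toNormalizedGCDMonoid F[X]
      exact Finset.lcm_dvd fun k hk => minpoly.dvd F _ (hall k (Finset.mem_range.1 hk))
    obtain ⟨g, hg⟩ := hdvd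
    exact ⟨g, 0, by rw [hg]; ring⟩

end Membership

/-! ### Lower bound for the dimension. -/

section Dimension

variable {F : Type*} [Field F] [Fintype F] {K : Type*} [Field K] [Algebra F K]

lemma exists_algebraMap_eq_of_pow_card_eq {x : K} (hx : x ^ Fintype.card F = x) :
    ∃ a : F, algebraMap F K a = x := by
  classical
  have hp0 : (X ^ Fintype.card F - X : K[X]) ≠ 0 :=
    FiniteField.X_pow_card_sub_X_ne_zero K Fintype.one_lt_card
  have hsub : Finset.univ.image (algebraMap F K) ⊆
      (X ^ Fintype.card F - X : K[X]).roots.toFinset := by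
    intro y hy
    obtain ⟨a, -, rfl⟩ := Finset.mem_image.1 hy
    rw [Multiset.mem_toFinset, mem_roots hp0]
    simp [← map_pow, FiniteField.pow_card]
  have heq := Finset.eq_of_subset_of_card_le hsub (by
    rw [Finset.card_image_of_injective _ (algebraMap F K).injective, Finset.card_univ]
    refine (Multiset.toFinset_card_le _).trans ((card_roots' _).trans ?_)
    rw [FiniteField.X_pow_card_sub_X_natDegree_eq K Fintype.one_lt_card])
  have hmem : x ∈ Finset.univ.image (algebraMap F K) := by
    rw [heq, Multiset.mem_toFinset, mem_roots hp0]
    simp [hx]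
  obtain ⟨a, -, ha⟩ := Finset.mem_image.1 hmem
  exact ⟨a, ha⟩

/-- Frobenius swaps `γ` and `γ⁻¹`, so their sum `t` lies in `F` and `γ` is a root of `X ^ 2 - t X +
1`. -/
lemma isIntegral_and_natDegree_minpoly_le_two {γ : K} (hγ : γ ^ (Fintype.card F + 1) = 1) :
    IsIntegral F γ ∧ (minpoly F γ).natDegree ≤ 2 := by
  have hγ0 : γ ≠ 0 := by rintro rfl; simp at hγ
  have hinv : γ ^ Fintype.card F = γ⁻¹ := eq_inv_of_mul_eq_one_left (by rw [← pow_succ, hγ])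
  obtain ⟨t, ht⟩ := exists_algebraMap_eq_of_pow_card_eq (F := F) (x := γ + γ⁻¹) (by
    have h := map_add (FiniteField.frobeniusAlgHom F K) γ γ⁻¹
    simp only [FiniteField.frobeniusAlgHom_apply] at h
    rw [h, inv_pow, hinv, inv_inv, add_comm])
  have hmonic : (X ^ 2 - C t * X + 1 : F[X]).Monic := by monicity!
  have hroot : aeval γ (X ^ 2 - C t * X + 1 : F[X]) = 0 := by
    simp [ht]
    field_simp
    ring
  refine ⟨⟨_, hmonic, hroot⟩, ?_⟩
  refine (natDegree_le_of_dvd (minpoly.dvd F γ hroot) hmonic.ne_zero).trans ?_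
  compute_degree

lemma le_finrank_bchCode {n : ℕ} {β : K} (hn : n = Fintype.card F + 1) (hβ : β ^ n = 1) (h : ℕ) :
    n ≤ Module.finrank F (bchCode F β n 3 h) + 4 := by
  have hpow : ∀ k, (β ^ k) ^ (Fintype.card F + 1) = 1 := fun k => by
    rw [← hn, ← pow_mul, mul_comm, pow_mul, hβ, one_pow]
  -- Each parity check takes values in `F[β ^ (h + k)]`, of dimension at most 2, so the two together
  -- impose at most four linear conditions over `F`.
  let A (k : ℕ) := Algebra.adjoin F {β ^ (h + k)}
  let γ (k : ℕ) : A k := ⟨β ^ (h + k), Algebra.self_mem_adjoin_singleton F _⟩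
  have hfin (k : ℕ) : Module.Finite F (A k) ∧ Module.finrank F (A k) ≤ 2 := by
    obtain ⟨h1, h2⟩ := isIntegral_and_natDegree_minpoly_le_two (hpow (h + k))
    have pb := Algebra.adjoin.powerBasis h1
    refine ⟨pb.finite, ?_⟩
    rw [(Algebra.adjoin.powerBasis h1).finrank]
    simpa using h2
  have := (hfin 0).1
  have := (hfin 1).1
  let ev : (Fin n → F) →ₗ[F] A 0 × A 1 :=
    (Fintype.linearCombination F fun j : Fin n => γ 0 ^ (j : ℕ)).prod
      (Fintype.linearCombination F fun j : Fin n => γ 1 ^ (j : ℕ))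
  have hker : LinearMap.ker ev ≤ bchCode F β n 3 h := by
    intro c hc
    rw [LinearMap.mem_ker] at hc
    rw [mem_bchCode hβ]
    have h0 := congrArg (fun x => (x.1 : K)) hc
    have h1 := congrArg (fun x => (x.2 : K)) hc
    intro k hk
    obtain rfl | rfl : k = 0 ∨ k = 1 := by omega
    · simpa [ev, Fintype.linearCombination_apply, γ] using h0
    · simpa [ev, Fintype.linearCombination_apply, γ] using h1
  have h1 := LinearMap.finrank_range_add_finrank_ker ev
  have h2 := Submodule.finrank_mono hker
  have h3 := Submodule.finrank_le (LinearMap.range ev)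
  rw [Module.finrank_prod] at h3
  have h4 := (hfin 0).2
  have h5 := (hfin 1).2
  rw [Module.finrank_fin_fun] at h1
  omega

end Dimension

/-! ### Cross-ratios and the minimum distance. -/

section MinimumDistance

/-- Under squaring, `x` has periods `i` and `s`, hence period `gcd(i, s) = 1`. -/
lemma sq_eq_self_of_pow_two_pow_eq_self {K : Type*} [Monoid K] {s i : ℕ} (hcop : Nat.gcd i s = 1)
    {x : K} (hi : x ^ 2 ^ i = x) (hs : x ^ 2 ^ s = x) : x ^ 2 = x := by
  have h1 : Function.IsPeriodicPt (fun y : K => y ^ 2) i x := by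
    rw [Function.IsPeriodicPt, Function.IsFixedPt, pow_iterate]; exact hi
  have h2 : Function.IsPeriodicPt (fun y : K => y ^ 2) s x := by
    rw [Function.IsPeriodicPt, Function.IsFixedPt, pow_iterate]; exact hs
  have h3 := h1.gcd h2
  rw [hcop] at h3
  simpa [Function.IsPeriodicPt, Function.IsFixedPt] using h3

variable {K : Type*} [Field K] [CharP K 2]

/-- The cross-ratio of four distinct `(2 ^ s + 1)`-th roots of unity is not fixed by the
`i`-th power of the Frobenius. -/
lemma crossRatio_pow_ne {s i : ℕ} (hcop : Nat.gcd i s = 1) {a b c d : K}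
    (ha : a ^ (2 ^ s + 1) = 1) (hb : b ^ (2 ^ s + 1) = 1) (hc : c ^ (2 ^ s + 1) = 1)
    (hd : d ^ (2 ^ s + 1) = 1) (hab : a ≠ b) (hac : a ≠ c) (had : a ≠ d) (hbc : b ≠ c)
    (hbd : b ≠ d) (hcd : c ≠ d) :
    (c - a) * (c ^ 2 ^ i - b ^ 2 ^ i) * ((d - b) * (d ^ 2 ^ i - a ^ 2 ^ i)) ≠
      (c - b) * (c ^ 2 ^ i - a ^ 2 ^ i) * ((d - a) * (d ^ 2 ^ i - b ^ 2 ^ i)) := by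
  intro heq
  have hinv : ∀ x : K, x ^ (2 ^ s + 1) = 1 → x ≠ 0 ∧ x ^ 2 ^ s = x⁻¹ := fun x hx =>
    ⟨by rintro rfl; simp at hx, eq_inv_of_mul_eq_one_left (by rw [← pow_succ, hx])⟩
  obtain ⟨ha0, ha⟩ := hinv a ha
  obtain ⟨hb0, hb⟩ := hinv b hb
  obtain ⟨hc0, hc⟩ := hinv c hc
  obtain ⟨hd0, hd⟩ := hinv d hd
  have e1 := sub_ne_zero.2 hab
  have e2 := sub_ne_zero.2 hac.symm
  have e3 := sub_ne_zero.2 had.symm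
  have e4 := sub_ne_zero.2 hbc.symm
  have e5 := sub_ne_zero.2 hbd.symm
  have e6 := sub_ne_zero.2 hcd
  set l := (c - a) * (d - b) / ((c - b) * (d - a)) with hl
  have hli : l ^ 2 ^ i = l := by
    have e3' := pow_ne_zero (2 ^ i) e3
    have e4' := pow_ne_zero (2 ^ i) e4
    simp only [hl, div_pow, mul_pow]
    rw [div_eq_div_iff (mul_ne_zero e4' e3') (mul_ne_zero e4 e3)]
    simp only [sub_pow_char_pow]
    linear_combination -heq
  -- The `2^s`-power map inverts each of the four points, which leaves the cross-ratio unchanged.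
  have hls : l ^ 2 ^ s = l := by
    have e3' := pow_ne_zero (2 ^ s) e3
    have e4' := pow_ne_zero (2 ^ s) e4
    simp only [hl, div_pow, mul_pow]
    rw [div_eq_div_iff (mul_ne_zero e4' e3') (mul_ne_zero e4 e3)]
    simp only [sub_pow_char_pow, ha, hb, hc, hd]
    field_simp
    ring
  have hsq := sq_eq_self_of_pow_two_pow_eq_self hcop hli hls
  have hl0 : l ≠ 0 := div_ne_zero (mul_ne_zero e2 e5) (mul_ne_zero e4 e3)
  have hl1 : l = 1 := mul_left_cancel₀ hl0 (by rw [← sq, hsq, mul_one])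
  rw [hl, div_eq_one_iff_eq (mul_ne_zero e4 e3)] at hl1
  exact mul_ne_zero e1 e6 (by linear_combination hl1)

lemma eq_zero_of_four_relations {ι : Type*} [Fintype ι] [DecidableEq ι] {s i : ℕ}
    (hcop : Nat.gcd i s = 1) {x e : ι → K} (hx : Function.Injective x)
    (hroot : ∀ j, x j ^ (2 ^ s + 1) = 1)
    (h00 : ∑ j, e j = 0) (h10 : ∑ j, e j * x j = 0) (h01 : ∑ j, e j * x j ^ 2 ^ i = 0)
    (h11 : ∑ j, e j * x j ^ (2 ^ i + 1) = 0) {T : Finset ι} (hT : T.card = 4)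
    (hsupp : ∀ j ∉ T, e j = 0) : ∀ j, e j = 0 := by
  intro j₃
  by_cases hj : j₃ ∈ T
  swap
  · exact hsupp _ hj
  by_contra hne
  have hcard : (T.erase j₃).card = 3 := by rw [Finset.card_erase_of_mem hj, hT]
  obtain ⟨j₁, j₂, j₄, h12, h14, h24, hTe⟩ := Finset.card_eq_three.1 hcard
  have hTe' : T = {j₃, j₁, j₂, j₄} := by rw [← Finset.insert_erase hj, hTe]
  have hnot : j₃ ∉ ({j₁, j₂, j₄} : Finset ι) := by rw [← hTe]; simp
  simp only [Finset.mem_insert, Finset.mem_singleton, not_or] at hnot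
  obtain ⟨h31, h32, h34⟩ := hnot
  have key : ∀ u v : K, ∑ j ∈ T, e j * ((x j - u) * (x j ^ 2 ^ i - v)) = 0 := by
    intro u v
    rw [Finset.sum_subset (Finset.subset_univ T)
      (fun j _ hj => by rw [hsupp j hj, zero_mul])]
    calc ∑ j, e j * ((x j - u) * (x j ^ 2 ^ i - v))
        = ∑ j, e j * x j ^ (2 ^ i + 1) - v * ∑ j, e j * x j - u * ∑ j, e j * x j ^ 2 ^ i
          + u * v * ∑ j, e j := by
          simp only [Finset.mul_sum, ← Finset.sum_sub_distrib, ← Finset.sum_add_distrib]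
          exact Finset.sum_congr rfl fun j _ => by ring
      _ = 0 := by rw [h00, h10, h01, h11]; ring
  -- Both choices of `u`, `v` kill the terms at `j₁` and `j₂`; eliminating `e j₄` between the two
  -- relations gives the forbidden cross-ratio identity, times `e j₃ ≠ 0`.
  have k1 := key (x j₁) (x j₂ ^ 2 ^ i)
  have k2 := key (x j₂) (x j₁ ^ 2 ^ i)
  rw [hTe', Finset.sum_insert (by simp [h31, h32, h34]), Finset.sum_insert (by simp [h12, h14]),
    Finset.sum_pair h24] at k1 k2
  refine crossRatio_pow_ne hcop (hroot j₁) (hroot j₂) (hroot j₃) (hroot j₄) (hx.ne h12)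
    (hx.ne (Ne.symm h31)) (hx.ne h14) (hx.ne (Ne.symm h32)) (hx.ne h24) (hx.ne h34)
    (i := i) ?_
  refine mul_left_cancel₀ hne ?_
  linear_combination (x j₄ - x j₂) * (x j₄ ^ 2 ^ i - x j₁ ^ 2 ^ i) * k1 -
    (x j₄ - x j₁) * (x j₄ ^ 2 ^ i - x j₂ ^ 2 ^ i) * k2

end MinimumDistance

open Classical in
lemma five_le_hammingNorm {F : Type*} [Field F] [Fintype F] {K : Type*} [Field K] [Algebra F K]
    {q s i h : ℕ} (hs : 1 < s) (hcop : Nat.gcd i s = 1)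
    (hq : q = 2 ^ s) (hF : Fintype.card F = q) (hh : 2 * h + 2 ^ i = q)
    {β : K} (hβ : IsPrimitiveRoot β (q + 1)) {c : Fin (q + 1) → F}
    (hc : c ∈ bchCode F β (q + 1) 3 h) (hne : c ≠ 0) : 5 ≤ hammingNorm c := by
  have : CharP F 2 := by
    have : Fact (Nat.Prime 2) := ⟨Nat.prime_two⟩
    exact charP_of_card_eq_prime_pow (f := s) (by rw [hF, hq])
  have : CharP K 2 := charP_of_injective_algebraMap (algebraMap F K).injective 2
  rw [mem_bchCode hβ.pow_eq_one] at hc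
  have hc0 := hc 0 (by norm_num)
  have hc1 := hc 1 (by norm_num)
  by_contra! hlt
  have hq4 : 4 ≤ q := by
    rw [hq]; exact (Nat.pow_le_pow_right (by norm_num) hs : 2 ^ 2 ≤ 2 ^ s)
  obtain ⟨T, hsub, -, hT⟩ := Finset.exists_subsuperset_card_eq
    (Finset.subset_univ (Finset.univ.filter fun j => c j ≠ 0)) (Nat.le_of_lt_succ hlt)
    (by simp; omega)
  have hfrob : ∀ k, ∑ j : Fin (q + 1), c j • (β ^ k) ^ (j : ℕ) = 0 →
      ∑ j : Fin (q + 1), c j • (β ^ (j : ℕ)) ^ (k * q) = 0 := by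
    intro k hk
    have := congrArg (FiniteField.frobeniusAlgHom F K) hk
    rw [map_sum, map_zero] at this
    rw [← this]
    refine Finset.sum_congr rfl fun j _ => ?_
    rw [map_smul, FiniteField.frobeniusAlgHom_apply, hF]
    ring_nf
  have hroot : ∀ j : Fin (q + 1), (β ^ (j : ℕ)) ^ (q + 1) = 1 := fun j => by
    rw [← pow_mul, mul_comm, pow_mul, hβ.pow_eq_one, one_pow]
  have hz := eq_zero_of_four_relations (s := s) (i := i) hcop
    (x := fun j : Fin (q + 1) => β ^ (j : ℕ)) (e := fun j => c j • (β ^ (j : ℕ)) ^ h)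
    (fun a b hab => Fin.ext (hβ.pow_inj a.2 b.2 hab)) (by rw [← hq]; exact hroot) ?_ ?_ ?_ ?_ hT
    (fun j hj => ?_)
  · refine hne (funext fun j => ?_)
    have hβ0 : β ≠ 0 := hβ.ne_zero (by omega)
    have := hz j
    simpa [hβ0] using this
  · rw [← hc0]
    exact Finset.sum_congr rfl fun j _ => by ring_nf
  · rw [← hc1]
    exact Finset.sum_congr rfl fun j _ => by rw [smul_mul_assoc]; ring_nf
  · rw [← hfrob _ hc1]
    refine Finset.sum_congr rfl fun j _ => ?_
    -- Modulo `q + 1`, `(h + 1) q ≡ h + 2^i`.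
    have e : (h + 1) * q = h + 2 ^ i + (q + 1) * h := by rw [← hh]; ring
    rw [e, pow_add _ _ ((q + 1) * h), pow_mul _ (q + 1) h, hroot, one_pow, mul_one, pow_add,
      smul_mul_assoc]
  · rw [← hfrob _ hc0]
    refine Finset.sum_congr rfl fun j _ => ?_
    -- Likewise `h q ≡ h + 2^i + 1`; the added `q + 1` avoids subtraction.
    have e : (h + 0) * q + (q + 1) = h + (2 ^ i + 1) + (q + 1) * h := by rw [← hh]; ring
    have e' : (β ^ (j : ℕ)) ^ ((h + 0) * q) = (β ^ (j : ℕ)) ^ (h + (2 ^ i + 1)) := by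
      have := congrArg (fun m => (β ^ (j : ℕ)) ^ m) e
      simpa only [pow_add _ _ ((q + 1) * h), pow_add _ _ (q + 1), pow_mul _ (q + 1) h, hroot,
        one_pow, mul_one] using this
    rw [e', pow_add _ h, smul_mul_assoc]
  · have : c j = 0 := by
      by_contra h0
      exact hj (hsub (by simpa using h0))
    simp [this]

end BCH

theorem mainTheorem6 {F : Type*} [Field F] [Fintype F] {K : Type*} [Field K] [Algebra F K]
    (q s i h : ℕ) (hs : 1 < s) (hi : 0 < i) (his : i < s) (hcop : Nat.gcd i s = 1)
    (hq : q = 2 ^ s) (hF : Fintype.card F = q) (hh : h = (q - 2 ^ i) / 2)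
    (β : K) (hβ : IsPrimitiveRoot β (q + 1)) :
    (BCH.HasParameters (BCH.bchCode F β (q + 1) 3 h) (q - 3) 5 ∧
      BCH.IsMDS (BCH.bchCode F β (q + 1) 3 h)) ∧
    (BCH.HasParameters (BCH.dualCode (BCH.bchCode F β (q + 1) 3 h)) 4 (q - 2) ∧
      BCH.IsMDS (BCH.dualCode (BCH.bchCode F β (q + 1) 3 h))) := by
  classical
  have hh' : 2 * h + 2 ^ i = q := by
    have h1 : 2 ^ i ≤ 2 ^ s := Nat.pow_le_pow_right (by norm_num) his.le
    have h2 : 2 ∣ 2 ^ i := dvd_pow_self 2 hi.ne'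
    have h3 : 2 ∣ 2 ^ s := dvd_pow_self 2 (by omega)
    omega
  have hq4 : 4 ≤ q := by
    rw [hq]; exact (Nat.pow_le_pow_right (by norm_num) hs : 2 ^ 2 ≤ 2 ^ s)
  have hd : ∀ c ∈ BCH.bchCode F β (q + 1) 3 h, c ≠ 0 → 5 ≤ hammingNorm c :=
    fun c hc hne => by
      convert BCH.five_le_hammingNorm hs hcop hq hF hh' hβ hc hne
  have hlow := BCH.le_finrank_bchCode (n := q + 1) (by rw [hF]) hβ.pow_eq_one h
  have hup := BCH.finrank_add_le (C := BCH.bchCode F β (q + 1) 3 h) (d := 5) (by omega)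
    (by norm_num) (fun c hc hne => by
    convert hd c hc hne)
  have hdim : Module.finrank F (BCH.bchCode F β (q + 1) 3 h) = q - 3 := by omega
  have hdual := BCH.finrank_dualCode (BCH.bchCode F β (q + 1) 3 h)
  have p1 : BCH.HasParameters (BCH.bchCode F β (q + 1) 3 h) (q - 3) 5 :=
    BCH.hasParameters_of_le_hammingNorm (by omega) hdim (by omega) (fun c hc hne => by
      convert hd c hc hne)
  have p2 : BCH.HasParameters (BCH.dualCode (BCH.bchCode F β (q + 1) 3 h)) 4 (q - 2) :=
    BCH.hasParameters_of_le_hammingNorm (by omega) (by omega) (by omega) (fun v hv hne => by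
      have := BCH.lt_hammingNorm_of_mem_dualCode (d := 5) (by omega) (by norm_num)
        (fun c hc hne => by convert hd c hc hne) hv hne
      rw [hdim] at this
      have h3 : q - 2 = q - 3 + 1 := by omega
      rw [h3]
      convert Nat.succ_le_of_lt this)
  exact ⟨⟨p1, _, _, p1, by omega⟩, ⟨p2, _, _, p2, by omega⟩⟩
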